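/- Let $-\infty\le\bar T<T<\infty$. Let $A,C:\mathbb R\to\mathbb R^{n\times n}$ and $\sigma:\mathbb R\to\mathbb R^{n\times m}$ with $\sigma$ measurable, put $\Sigma(t)=\sigma(t)\sigma(t)'$ (a prime on a matrix or vector is the transpose), and assume that on $(\bar T,T]$ the matrix $C(t)$ is symmetric and $A,C,\Sigma$ are piecewise continuous and locally bounded. Assume that the system $\dot x_t=A(t)x_t+\sigma(t)u_t$ is controllable: for all $\bar T<a<b\le T$ and $x,y\in\mathbb R^n$ some $u\in L_2(a,b)$ steers $x_a=x$ to $x_b=y$. Let $P_t,S_t,Q_t$ ($P_t,Q_t$ symmetric) be continuous on $(\bar T,T]$ and satisfy there (at every time at which $A,C,\Sigma$ are continuous) $$-\dot P_t=A'P_t+P_tA+C+P_t\Sigma P_t,\qquad -\dot S_t=(A+\Sigma P_t)'S_t,\qquad -\dot Q_t=S_t'\Sigma S_t .$$ Let $\bar T<t_1<t_2\le T$, and let $p_t$ be a continuous symmetric solution on $[t_1,t_2]$, in the same sense, of the differential Riccati equation (DRE) $-\dot p_t=A'p_t+p_tA+C+p_t\Sigma p_t$. Put $\mathcal P_t(x)=\tfrac12x'p_tx$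 and $\phi_t(x,z)=\tfrac12x'P_tx+x'S_tz+\tfrac12z'Q_tz$, and for $f:\mathbb R^n\to\mathbb R$ let $$\mathcal S_{t_1}^{t_2}[f](x)=\sup_{u\in L_2(t_1,t_2)}\Big\{\int_{t_1}^{t_2}\big(\tfrac12x_t'C(t)x_t-\tfrac12|u_t|^2\big)\,dt+f(x_{t_2})\Big\},\qquad \dot x_t=A(t)x_t+\sigma(t)u_t,\ x_{t_1}=x .$$ Assume that $p_{t_2}\succeq P_{t_2}$, that $S_{t_2}$ is nonsingular, and that $\mathcal S_{t_1}^{t_2}[\mathcal P_{t_2}]=\mathcal P_{t_1}$ and $\mathcal S_{t_1}^{t_2}[\phi_{t_2}(\cdot,z)]=\phi_{t_1}(\cdot,z)$ for all $z\in\mathbb R^n$. Then the semiconvex dual of $\mathcal P_{t_1}$ under the kernel $\phi_{t_1}$ exists, that is, $x\mapsto\mathcal P_{t_1}(x)-\tfrac12x'P_{t_1}x$ is convex and $S_{t_1}$ is nonsingular, and it equals the semiconvex dual of $\mathcal P_{t_2}$ under the kernel $\phi_{t_2}$: for all $z\in\mathbb R^n$, in $\mathbb R\cup\{-\infty\}$,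 $$\inf_x\big[\mathcal P_{t_2}(x)-\phi_{t_2}(x,z)\big]=\inf_y\big[\mathcal P_{t_1}(y)-\phi_{t_1}(y,z)\big].$$ This common dual is finite for every $z$ if and only if $p_{t_2}-P_{t_2}$ is invertible. In that case $p_{t_1}-P_{t_1}\succ0$, the dual is $\tfrac12z'q_{t_2}z$ with $$q_{t_2}=-S_{t_2}'(p_{t_2}-P_{t_2})^{-1}S_{t_2}-Q_{t_2}=-S_{t_1}'(p_{t_1}-P_{t_1})^{-1}S_{t_1}-Q_{t_1},$$ the matrix $Q_{t_1}-Q_{t_2}-S_{t_2}'(p_{t_2}-P_{t_2})^{-1}S_{t_2}$ is invertible, and $$p_{t_1}=P_{t_1}-S_{t_1}\big(Q_{t_1}-Q_{t_2}-S_{t_2}'(p_{t_2}-P_{t_2})^{-1}S_{t_2}\big)^{-1}S_{t_1}'.$$ -/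

import Mathlib

open Matrix MeasureTheory Set

noncomputable section

namespace DRE

/-- The time horizon `(Tbar, T]`, where `Tbar = -∞` is allowed. -/
def horizon (Tbar : EReal) (T : ℝ) : Set ℝ := {t | Tbar < (t : EReal) ∧ t ≤ T}

/-- On every compact interval with end points in `J` there are only finitely many
discontinuities. -/
def PiecewiseContinuousOn {n : ℕ} (F : ℝ → Matrix (Fin n) (Fin n) ℝ) (J : Set ℝ) : Prop :=
  ∃ D : Set ℝ, (∀ a ∈ J, ∀ b ∈ J, (D ∩ Icc a b).Finite) ∧
    ∀ t ∈ J, t ∉ D → ContinuousWithinAt F J t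

/-- Boundedness on every compact interval with end points in `J`. -/
def LocallyBoundedOn {n : ℕ} (F : ℝ → Matrix (Fin n) (Fin n) ℝ) (J : Set ℝ) : Prop :=
  ∀ a ∈ J, ∀ b ∈ J, ∃ M : ℝ, ∀ t ∈ Icc a b, ∀ i j, |F t i j| ≤ M

/-! ### The controlled linear system and the quadratic payoff -/

/-- `Σ(t) = σ(t) σ(t)'`. -/
def diffusion {n m : ℕ} (σ : ℝ → Matrix (Fin n) (Fin m) ℝ) (t : ℝ) : Matrix (Fin n) (Fin n) ℝ :=
  σ t * (σ t)ᵀ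

/-- `u ∈ L₂(a, b)`. -/
def IsControl {m : ℕ} (a b : ℝ) (u : ℝ → Fin m → ℝ) : Prop :=
  MemLp u 2 (volume.restrict (Icc a b))

/-- `x` is the (absolutely continuous) solution on `[a, b]` of `x' = A(t) x + σ(t) u`,
`x(a) = x₀`, in integrated form. -/
structure IsTrajectory {n m : ℕ} (A : ℝ → Matrix (Fin n) (Fin n) ℝ)
    (σ : ℝ → Matrix (Fin n) (Fin m) ℝ) (a b : ℝ) (u : ℝ → Fin m → ℝ) (x₀ : Fin n → ℝ)
    (x : ℝ → Fin n → ℝ) : Prop where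
  continuousOn : ContinuousOn x (Icc a b)
  integrable : ∀ i, IntervalIntegrable (fun s => (A s *ᵥ x s + σ s *ᵥ u s) i) volume a b
  eq : ∀ t ∈ Icc a b, ∀ i, x t i = x₀ i + ∫ s in a..t, (A s *ᵥ x s + σ s *ᵥ u s) i

/-- Every state can be steered to every state on every interval `[a, b]` with
`a < b` and `a, b ∈ J`. -/
def Controllable {n m : ℕ} (A : ℝ → Matrix (Fin n) (Fin n) ℝ)
    (σ : ℝ → Matrix (Fin n) (Fin m) ℝ) (J : Set ℝ) : Prop :=
  ∀ a ∈ J, ∀ b ∈ J, a < b → ∀ x₀ y : Fin n → ℝ,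
    ∃ u x, IsControl a b u ∧ IsTrajectory A σ a b u x₀ x ∧ x b = y

/-- The operator `S_a^b[f](x₀) = sup_u { ∫_a^b (½ x' C x - ½ |u|²) dt + f(x_b) }`, the supremum
being over controls in `L₂(a, b)` and the corresponding trajectories that start at `x₀`. -/
def valueOp {n m : ℕ} (A C : ℝ → Matrix (Fin n) (Fin n) ℝ)
    (σ : ℝ → Matrix (Fin n) (Fin m) ℝ) (a b : ℝ) (f : (Fin n → ℝ) → ℝ) (x₀ : Fin n → ℝ) : EReal :=
  sSup {r : EReal | ∃ u x, IsControl a b u ∧ IsTrajectory A σ a b u x₀ x ∧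
    r = (((∫ t in a..b, (1 / 2 * (x t ⬝ᵥ C t *ᵥ x t) - 1 / 2 * (u t ⬝ᵥ u t))) + f (x b) : ℝ) :
      EReal)}

/-! ### Riccati equations -/

/-- `p` is a (symmetric) solution on the interval `J` of
`-p' = A' p + p A + C + p Σ p`: it is continuous, and the equation holds at every time at which
the coefficients are continuous. -/
structure IsRiccatiSolution {n : ℕ} (A C Sig : ℝ → Matrix (Fin n) (Fin n) ℝ) (J : Set ℝ)
    (p : ℝ → Matrix (Fin n) (Fin n) ℝ) : Prop where
  symm : ∀ t ∈ J, (p t).IsSymm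
  continuousOn : ContinuousOn p J
  deriv : ∀ t ∈ J, ContinuousWithinAt A J t → ContinuousWithinAt C J t →
    ContinuousWithinAt Sig J t → ∀ i j, HasDerivWithinAt (fun s => p s i j)
      (-((A t)ᵀ * p t + p t * A t + C t + p t * Sig t * p t) i j) J t

/-- `(P, S, Q)` is a solution on `J` of the bivariate Riccati system
`-P' = A' P + P A + C + P Σ P`, `-S' = (A + Σ P)' S`, `-Q' = S' Σ S`. -/
structure IsBiRiccatiSolution {n : ℕ} (A C Sig : ℝ → Matrix (Fin n) (Fin n) ℝ) (J : Set ℝ)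
    (P S Q : ℝ → Matrix (Fin n) (Fin n) ℝ) : Prop where
  riccati : IsRiccatiSolution A C Sig J P
  symm : ∀ t ∈ J, (Q t).IsSymm
  continuousOn_S : ContinuousOn S J
  continuousOn_Q : ContinuousOn Q J
  deriv_S : ∀ t ∈ J, ContinuousWithinAt A J t → ContinuousWithinAt C J t →
    ContinuousWithinAt Sig J t → ∀ i j, HasDerivWithinAt (fun s => S s i j)
      (-((A t + Sig t * P t)ᵀ * S t) i j) J t
  deriv_Q : ∀ t ∈ J, ContinuousWithinAt A J t → ContinuousWithinAt C J t →
    ContinuousWithinAt Sig J t → ∀ i j, HasDerivWithinAt (fun s => Q s i j)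
      (-((S t)ᵀ * Sig t * S t) i j) J t

/-! ### Quadratic functions and semiconvex duality -/

/-- `½ x' M x`. -/
def quad {n : ℕ} (M : Matrix (Fin n) (Fin n) ℝ) (x : Fin n → ℝ) : ℝ :=
  1 / 2 * (x ⬝ᵥ M *ᵥ x)

/-- `½ x' P x + x' S z + ½ z' Q z`. -/
def biquad {n : ℕ} (P S Q : Matrix (Fin n) (Fin n) ℝ) (x z : Fin n → ℝ) : ℝ :=
  1 / 2 * (x ⬝ᵥ P *ᵥ x) + x ⬝ᵥ S *ᵥ z + 1 / 2 * (z ⬝ᵥ Q *ᵥ z)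

/-- `f` is uniformly semiconvex with matrix constant `K`: `f(x) + ½ x' K x` is convex. -/
def UniformlySemiconvex {n : ℕ} (K : Matrix (Fin n) (Fin n) ℝ) (f : (Fin n → ℝ) → ℝ) : Prop :=
  ConvexOn ℝ univ (fun x => f x + quad K x)

/-- The semiconvex dual `z ↦ inf_x [f(x) - φ(x, z)]` of `f` under the kernel `φ`, with values in
the extended reals. -/
def semiconvexDual {n : ℕ} (φ : (Fin n → ℝ) → (Fin n → ℝ) → ℝ) (f : (Fin n → ℝ) → ℝ)
    (z : Fin n → ℝ) : EReal :=
  ⨅ x : Fin n → ℝ, ((f x - φ x z : ℝ) : EReal)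

/-! ### The standing assumptions -/

/-- The assumptions on the coefficients and on the kernel parameters over `(Tbar, T]`. -/
structure StandingAssumptions {n m : ℕ} (Tbar : EReal) (T : ℝ)
    (A C : ℝ → Matrix (Fin n) (Fin n) ℝ) (σ : ℝ → Matrix (Fin n) (Fin m) ℝ)
    (P S Q : ℝ → Matrix (Fin n) (Fin n) ℝ) : Prop where
  symm_C : ∀ t ∈ horizon Tbar T, (C t).IsSymm
  pc_A : PiecewiseContinuousOn A (horizon Tbar T)
  pc_C : PiecewiseContinuousOn C (horizon Tbar T)
  pc_Sig : PiecewiseContinuousOn (diffusion σ) (horizon Tbar T)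
  bdd_A : LocallyBoundedOn A (horizon Tbar T)
  bdd_C : LocallyBoundedOn C (horizon Tbar T)
  bdd_Sig : LocallyBoundedOn (diffusion σ) (horizon Tbar T)
  measurable_σ : ∀ i j, Measurable (fun t => σ t i j)
  controllable : Controllable A σ (horizon Tbar T)
  kernel : IsBiRiccatiSolution A C (diffusion σ) (horizon Tbar T) P S Q

/-- The assumptions that link the solution `p` of the Riccati equation on `[t₁, t₂]` with the
kernel parameters `(P, S, Q)`. -/
structure DualityAssumptions {n m : ℕ} (A C : ℝ → Matrix (Fin n) (Fin n) ℝ)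
    (σ : ℝ → Matrix (Fin n) (Fin m) ℝ) (P S Q p : ℝ → Matrix (Fin n) (Fin n) ℝ)
    (t₁ t₂ : ℝ) : Prop where
  lt : t₁ < t₂
  riccati : IsRiccatiSolution A C (diffusion σ) (Icc t₁ t₂) p
  le : (p t₂ - P t₂).PosSemidef
  nonsingular : IsUnit (S t₂).det
  value_p : ∀ x, valueOp A C σ t₁ t₂ (quad (p t₂)) x = (quad (p t₁) x : EReal)
  value_kernel : ∀ z x, valueOp A C σ t₁ t₂ (fun y => biquad (P t₂) (S t₂) (Q t₂) y z) x =
    (biquad (P t₁) (S t₁) (Q t₁) x z : EReal)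

end DRE

end

/-!
The Riccati equation is reduced to an explicitly solvable one. The coefficient matrix `S` of the
kernel is a fundamental matrix of the linear equation `S' = -(A + Σ P)ᵀ S`, so it stays nonsingular
on `[t₁, t₂]` (`isUnit_det_of_linear_ode`). In the coordinates given by `S`, the difference of the
two Riccati solutions `p` and `P` becomes the reduced solution `r = S⁻¹ (p - P) S⁻ᵀ`, which
satisfies `r' = -r B r` with `B = Sᵀ Σ S ⪰ 0`, while `Q' = -B` (`hasDerivAt_reduced`).

Two facts about `r` follow, collected in `reduced_propagation`.
* `r` is nonincreasing, so `r(t₁) ⪰ r(t₂) ⪰ 0`; this is the semiconvexity of `½ xᵀ p(t₁) x`.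
* With `W = Q(t₁) - Q(t₂)` one has `r(t₁) (1 - W r(t₂)) = r(t₂)`, which for nonsingular `r` says
  that `r⁻¹ + Q` is constant. It is proved by uniqueness for a linear equation, and needs no
  invertibility of `r`.

In the variable `w = Sᵀ x` the dual at either time is `inf_w [½ wᵀ r w - wᵀ z] - ½ zᵀ Q z`. It
equals `-½ (wᵀ z + zᵀ Q z)` if `z = r w` for some `w`, and `-∞` if `z` is not in the range of `r`
(`semiconvexDual_of_reduced`, `semiconvexDual_eq_bot_of_reduced`). The second fact carries a
solution of `r(t₂) w = z` to the solution `w - W z` of `r(t₁) w = z` and back, and leaves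
`wᵀ z + zᵀ Q z` unchanged; hence the duals agree. They are finite for all `z` exactly when `r(t₂)`
is surjective, that is, when `p(t₂) - P(t₂)` is invertible, and then all the matrix formulas are
rewritings of `r(t₁)⁻¹ = r(t₂)⁻¹ - W`.

All differential equations hold off a finite set of times only; the derivative arguments are
therefore reduced to `le_of_hasDerivAt_nonneg_off_finite`.
-/

namespace DRE

/-! ### Monotonicity and linear differential equations with exceptional times -/

theorem le_of_hasDerivAt_nonneg_off_finite {D : Set ℝ} (hD : D.Finite) {f f' : ℝ → ℝ} {a b : ℝ}
    (hab : a ≤ b) (hc : ContinuousOn f (Icc a b))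
    (hf : ∀ t ∈ Ioo a b, t ∉ D → HasDerivAt f (f' t) t)
    (h0 : ∀ t ∈ Ioo a b, t ∉ D → 0 ≤ f' t) : f a ≤ f b := by
  induction D, hD using Set.Finite.induction_on generalizing a b with
  | empty =>
    refine monotoneOn_of_deriv_nonneg (convex_Icc a b) hc ?_ ?_ (left_mem_Icc.2 hab)
      (right_mem_Icc.2 hab) hab
    · rw [interior_Icc]
      exact fun t ht => (hf t ht (notMem_empty t)).differentiableAt.differentiableWithinAt
    · rw [interior_Icc]
      intro t ht
      rw [(hf t ht (notMem_empty t)).deriv]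
      exact h0 t ht (notMem_empty t)
  | @insert c D _ _ ih =>
    have key : ∀ {x y}, x ≤ y → a ≤ x → y ≤ b → c ∉ Ioo x y → f x ≤ f y := by
      intro x y hxy hx hy hcxy
      have hsub : Ioo x y ⊆ Ioo a b := Ioo_subset_Ioo hx hy
      have hn : ∀ t ∈ Ioo x y, t ∉ D → t ∉ insert c D := by
        rintro t ht htD (rfl | h)
        exacts [hcxy ht, htD h]
      exact ih hxy (hc.mono (Icc_subset_Icc hx hy))
        (fun t ht htD => hf t (hsub ht) (hn t ht htD)) fun t ht htD => h0 t (hsub ht) (hn t ht htD)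
    by_cases hcm : c ∈ Ioo a b
    · exact (key hcm.1.le le_rfl hcm.2.le fun h => lt_irrefl _ h.2).trans
        (key hcm.2.le hcm.1.le le_rfl fun h => lt_irrefl _ h.1)
    · exact key hab le_rfl le_rfl hcm

theorem abs_dotProduct_mulVec_le {n : ℕ} {G : Matrix (Fin n) (Fin n) ℝ} {M : ℝ}
    (hG : ∀ i j, |G i j| ≤ M) (y : Fin n → ℝ) : |y ⬝ᵥ G *ᵥ y| ≤ M * n * (y ⬝ᵥ y) := by
  have h1 : ∀ i j, |y i * (G i j * y j)| ≤ M / 2 * (y i * y i) + M / 2 * (y j * y j) := by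
    intro i j
    have hM : 0 ≤ M := (abs_nonneg _).trans (hG i j)
    calc |y i * (G i j * y j)| = |G i j| * (|y i| * |y j|) := by rw [abs_mul, abs_mul]; ring
      _ ≤ M * (|y i| * |y j|) := by gcongr; exact hG i j
      _ ≤ M * ((|y i| * |y i| + |y j| * |y j|) / 2) := by
        gcongr
        nlinarith [sq_nonneg (|y i| - |y j|)]
      _ = _ := by rw [abs_mul_abs_self, abs_mul_abs_self]; ring
  calc |y ⬝ᵥ G *ᵥ y| = |∑ i, ∑ j, y i * (G i j * y j)| := by
        simp only [dotProduct, mulVec, Finset.mul_sum]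
    _ ≤ ∑ i, ∑ j, (M / 2 * (y i * y i) + M / 2 * (y j * y j)) :=
        (Finset.abs_sum_le_sum_abs _ _).trans <| Finset.sum_le_sum fun i _ =>
          (Finset.abs_sum_le_sum_abs _ _).trans <| Finset.sum_le_sum fun j _ => h1 i j
    _ = M * n * (y ⬝ᵥ y) := by
        simp only [Finset.sum_add_distrib, Finset.sum_const, ← Finset.mul_sum, dotProduct,
          Finset.card_univ, Fintype.card_fin, nsmul_eq_mul]
        ring

/-- A solution of a linear differential equation `y' = G y` with bounded coefficients that vanishes
at one end of an interval vanishes at the other end. With `K` a bound for `(|y|²)' / |y|²`, the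
functions `|y|² exp (K t)` and `-|y|² exp (-K t)` are monotone. -/
theorem linear_ode_eq_zero_iff {n : ℕ} {D : Set ℝ} (hD : D.Finite)
    {G : ℝ → Matrix (Fin n) (Fin n) ℝ} {y : ℝ → Fin n → ℝ} {a b M : ℝ} (hab : a ≤ b)
    (hc : ContinuousOn y (Icc a b))
    (hy : ∀ t ∈ Ioo a b, t ∉ D → HasDerivAt y (G t *ᵥ y t) t)
    (hG : ∀ t ∈ Ioo a b, ∀ i j, |G t i j| ≤ M) : y a = 0 ↔ y b = 0 := by
  set f : ℝ → ℝ := fun t => y t ⬝ᵥ y t with hf_def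
  have hf : ∀ t ∈ Ioo a b, t ∉ D → HasDerivAt f (2 * (y t ⬝ᵥ G t *ᵥ y t)) t := by
    intro t ht htD
    have hi := hasDerivAt_pi.1 (hy t ht htD)
    have hs : HasDerivAt f (∑ i, ((G t *ᵥ y t) i * y t i + y t i * (G t *ᵥ y t) i)) t :=
      HasDerivAt.fun_sum fun i _ => (hi i).mul (hi i)
    convert hs using 1
    simp only [dotProduct, Finset.mul_sum]
    exact Finset.sum_congr rfl fun i _ => by ring
  have hfc : ContinuousOn f (Icc a b) := by
    have hi := continuousOn_pi.1 hc
    exact continuousOn_finsetSum _ fun i _ => (hi i).mul (hi i)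
  have hB : ∀ t ∈ Ioo a b, |2 * (y t ⬝ᵥ G t *ᵥ y t)| ≤ 2 * M * n * f t := by
    intro t ht
    have := abs_dotProduct_mulVec_le (hG t ht) (y t)
    rw [abs_mul, abs_two]
    simp only [hf_def]
    linarith
  have hexp : ∀ k t : ℝ, HasDerivAt (fun s => Real.exp (k * s)) (Real.exp (k * t) * k) t :=
    fun k t => by simpa using ((hasDerivAt_id t).const_mul k).exp
  have hexpc : ∀ k : ℝ, ContinuousOn (fun s => Real.exp (k * s)) (Icc a b) :=
    fun k => (by fun_prop : Continuous fun s => Real.exp (k * s)).continuousOn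
  have hpos : ∀ t, 0 ≤ f t := fun t => Finset.sum_nonneg fun i _ => mul_self_nonneg _
  have h1 : f a * Real.exp (2 * M * n * a) ≤ f b * Real.exp (2 * M * n * b) :=
    le_of_hasDerivAt_nonneg_off_finite (f := fun t => f t * Real.exp (2 * M * n * t)) hD hab
      (hfc.mul (hexpc _)) (fun t ht htD => (hf t ht htD).mul (hexp _ t)) fun t ht _ => by
        have := (abs_le.1 (hB t ht)).1
        nlinarith [Real.exp_pos (2 * M * n * t)]
  have h2 : -(f a * Real.exp (-(2 * M * n) * a)) ≤ -(f b * Real.exp (-(2 * M * n) * b)) :=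
    le_of_hasDerivAt_nonneg_off_finite (f := fun t => -(f t * Real.exp (-(2 * M * n) * t))) hD hab
      (hfc.mul (hexpc _)).neg (fun t ht htD => ((hf t ht htD).mul (hexp _ t)).neg) fun t ht _ => by
        have := (abs_le.1 (hB t ht)).2
        nlinarith [Real.exp_pos (-(2 * M * n) * t)]
  have h0 : ∀ t, y t = 0 ↔ f t = 0 := fun t => dotProduct_self_eq_zero.symm
  rw [h0, h0]
  constructor
  · intro h
    rw [h, zero_mul, neg_zero, le_neg, neg_zero] at h2
    exact le_antisymm (nonpos_of_mul_nonpos_left h2 (Real.exp_pos _)) (hpos b)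
  · intro h
    rw [h, zero_mul] at h1
    exact le_antisymm (nonpos_of_mul_nonpos_left h1 (Real.exp_pos _)) (hpos a)

/-! ### Calculus of matrix-valued functions -/

section MatrixCalculus

-- Mathlib has no global norm on matrices; all norms that induce the entrywise topology give the
-- same derivatives.
attribute [local instance] Matrix.linftyOpNormedAddCommGroup Matrix.linftyOpNormedSpace
  Matrix.linftyOpNormedRing Matrix.linftyOpNormedAlgebra

theorem hasDerivAt_matrix {m n : ℕ} {F : ℝ → Matrix (Fin m) (Fin n) ℝ}
    {F' : Matrix (Fin m) (Fin n) ℝ} {t : ℝ}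
    (h : ∀ i j, HasDerivAt (fun s => F s i j) (F' i j) t) : HasDerivAt F F' t :=
  hasDerivAt_pi.2 fun i => hasDerivAt_pi.2 (h i)

theorem HasDerivAt.matrix_entry {m n : ℕ} {F : ℝ → Matrix (Fin m) (Fin n) ℝ}
    {F' : Matrix (Fin m) (Fin n) ℝ} {t : ℝ}
    (h : HasDerivAt F F' t) (i j) : HasDerivAt (fun s => F s i j) (F' i j) t :=
  hasDerivAt_pi.1 (hasDerivAt_pi.1 h i) j

theorem HasDerivAt.matrix_transpose {m n : ℕ} {F : ℝ → Matrix (Fin m) (Fin n) ℝ}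
    {F' : Matrix (Fin m) (Fin n) ℝ} {t : ℝ}
    (h : HasDerivAt F F' t) : HasDerivAt (fun s => (F s)ᵀ) F'ᵀ t :=
  hasDerivAt_matrix fun i j => HasDerivAt.matrix_entry h j i

theorem HasDerivAt.matrix_inv {n : ℕ} {F : ℝ → Matrix (Fin n) (Fin n) ℝ}
    {F' : Matrix (Fin n) (Fin n) ℝ} {t : ℝ}
    (h : HasDerivAt F F' t) (hF : IsUnit (F t).det) :
    HasDerivAt (fun s => (F s)⁻¹) (-((F t)⁻¹ * F' * (F t)⁻¹)) t := by
  obtain ⟨u, hu⟩ := (isUnit_iff_isUnit_det _).2 hF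
  have h1 := hasFDerivAt_ringInverse (𝕜 := ℝ) u
  rw [hu] at h1
  have h2 := h1.comp_hasDerivAt t h
  simp only [nonsing_inv_eq_ringInverse, ← hu, Ring.inverse_unit]
  simpa using! h2

theorem exists_entry_bound_of_continuousOn {m n : ℕ} {F : ℝ → Matrix (Fin m) (Fin n) ℝ} {a b : ℝ}
    (hF : ContinuousOn F (Icc a b)) : ∃ M, ∀ t ∈ Icc a b, ∀ i j, |F t i j| ≤ M := by
  obtain ⟨M, hM⟩ := isCompact_Icc.exists_bound_of_continuousOn
    (f := fun t => ∑ i, ∑ j, |F t i j|) (by fun_prop)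
  refine ⟨M, fun t ht i j => le_trans ?_ ((le_abs_self _).trans (hM t ht))⟩
  exact (Finset.single_le_sum (f := fun j => |F t i j|) (fun _ _ => abs_nonneg _)
    (Finset.mem_univ j)).trans (Finset.single_le_sum (f := fun i => ∑ j, |F t i j|)
      (fun _ _ => Finset.sum_nonneg fun _ _ => abs_nonneg _) (Finset.mem_univ i))

theorem exists_entry_bound_mul {l m n : ℕ} {F : ℝ → Matrix (Fin l) (Fin m) ℝ}
    {G : ℝ → Matrix (Fin m) (Fin n) ℝ} {s : Set ℝ} (hF : ∃ M, ∀ t ∈ s, ∀ i j, |F t i j| ≤ M)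
    (hG : ∃ M, ∀ t ∈ s, ∀ i j, |G t i j| ≤ M) : ∃ M, ∀ t ∈ s, ∀ i j, |(F t * G t) i j| ≤ M := by
  obtain ⟨M, hM⟩ := hF
  obtain ⟨N, hN⟩ := hG
  refine ⟨m * (M * N), fun t ht i j => ?_⟩
  rw [mul_apply]
  calc |∑ k, F t i k * G t k j| ≤ ∑ _k : Fin m, M * N :=
        (Finset.abs_sum_le_sum_abs _ _).trans <| Finset.sum_le_sum fun k _ => by
          rw [abs_mul]
          exact mul_le_mul (hM t ht i k) (hN t ht k j) (abs_nonneg _)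
            ((abs_nonneg _).trans (hM t ht i k))
    _ = m * (M * N) := by simp

theorem HasDerivAt.matrix_mulVec_const {m n : ℕ} {F : ℝ → Matrix (Fin m) (Fin n) ℝ}
    {F' : Matrix (Fin m) (Fin n) ℝ} {t : ℝ} (h : HasDerivAt F F' t) (v : Fin n → ℝ) :
    HasDerivAt (fun s => F s *ᵥ v) (F' *ᵥ v) t :=
  hasDerivAt_pi.2 fun i => HasDerivAt.fun_sum (u := Finset.univ) fun j _ =>
    (HasDerivAt.matrix_entry h i j).mul_const (v j)

/-! ### Matrix differential equations -/

/-- A matrix solution of `S' = G S` that is nonsingular at the right end is nonsingular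
everywhere. -/
theorem isUnit_det_of_linear_ode {n : ℕ} {D : Set ℝ} (hD : D.Finite)
    {G S : ℝ → Matrix (Fin n) (Fin n) ℝ} {a b : ℝ} (hc : ContinuousOn S (Icc a b))
    (hS : ∀ t ∈ Ioo a b, t ∉ D → HasDerivAt S (G t * S t) t)
    (hG : ∃ M, ∀ t ∈ Icc a b, ∀ i j, |G t i j| ≤ M) (hb : IsUnit (S b).det) :
    ∀ t ∈ Icc a b, IsUnit (S t).det := by
  obtain ⟨M, hM⟩ := hG
  intro t ht
  rw [← isUnit_iff_isUnit_det] at hb ⊢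
  rw [← mulVec_injective_iff_isUnit] at hb ⊢
  refine (injective_iff_map_eq_zero (S t).mulVecLin).2 fun v hv => ?_
  have hsub : Icc t b ⊆ Icc a b := Icc_subset_Icc_left ht.1
  have hsub' : Ioo t b ⊆ Ioo a b := Ioo_subset_Ioo_left ht.1
  have hv' : S b *ᵥ v = 0 := by
    refine (linear_ode_eq_zero_iff (y := fun s => S s *ᵥ v) (G := G) (M := M) hD ht.2 ?_ ?_ ?_).1 hv
    · have := hc.mono hsub
      fun_prop
    · intro s hs hsD
      rw [mulVec_mulVec]
      exact HasDerivAt.matrix_mulVec_const (hS s (hsub' hs) hsD) v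
    · exact fun s hs => hM s (Ioo_subset_Icc_self (hsub' hs))
  exact hb (hv'.trans (mulVec_zero _).symm)

/-- The quadratic equation `r' = -r B r` with `B ⪰ 0` makes `r` nonincreasing. -/
theorem posSemidef_sub_of_reduced_riccati {n : ℕ} {D : Set ℝ} (hD : D.Finite)
    {r B : ℝ → Matrix (Fin n) (Fin n) ℝ} {a b : ℝ} (hab : a ≤ b) (hc : ContinuousOn r (Icc a b))
    (hr : ∀ t ∈ Ioo a b, t ∉ D → HasDerivAt r (-(r t * B t * r t)) t)
    (hsymm : ∀ t ∈ Icc a b, (r t).IsSymm) (hB : ∀ t, (B t).PosSemidef) :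
    (r a - r b).PosSemidef := by
  refine PosSemidef.of_dotProduct_mulVec_nonneg ?_ fun v => ?_
  · have h := (hsymm a (left_mem_Icc.2 hab)).sub (hsymm b (right_mem_Icc.2 hab))
    simpa [IsHermitian] using! h
  · have h := le_of_hasDerivAt_nonneg_off_finite (f := fun t => -(v ⬝ᵥ r t *ᵥ v))
      (f' := fun t => (r t *ᵥ v) ⬝ᵥ B t *ᵥ (r t *ᵥ v)) hD hab (by unfold dotProduct; fun_prop) ?_
      fun t _ _ => by simpa using (hB t).dotProduct_mulVec_nonneg (r t *ᵥ v)
    · simp only [star_trivial, sub_mulVec, dotProduct_sub]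
      linarith
    · intro t ht htD
      have h1 := hasDerivAt_pi.1 (HasDerivAt.matrix_mulVec_const (hr t ht htD) v)
      have h2 : HasDerivAt (fun t => v ⬝ᵥ r t *ᵥ v) (v ⬝ᵥ (-(r t * B t * r t)) *ᵥ v) t :=
        HasDerivAt.fun_sum fun i _ => (h1 i).const_mul (v i)
      refine h2.neg.congr_deriv ?_
      have h3 : (r t *ᵥ v) = v ᵥ* r t := by
        rw [← mulVec_transpose, (hsymm t (Ioo_subset_Icc_self ht)).eq]
      rw [neg_mulVec, dotProduct_neg, neg_neg, ← mulVec_mulVec, ← mulVec_mulVec,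
        dotProduct_mulVec v (r t), ← h3]

/-- The explicit solution of `r' = -r B r` in terms of a primitive `Q` of `-B`. The difference
of the two sides satisfies a linear differential equation and vanishes at `b`. -/
theorem reduced_riccati_formula {n : ℕ} {D : Set ℝ} (hD : D.Finite)
    {r Q B : ℝ → Matrix (Fin n) (Fin n) ℝ} {a b : ℝ} (hab : a ≤ b) (hc : ContinuousOn r (Icc a b))
    (hQc : ContinuousOn Q (Icc a b))
    (hr : ∀ t ∈ Ioo a b, t ∉ D → HasDerivAt r (-(r t * B t * r t)) t)
    (hQ : ∀ t ∈ Ioo a b, t ∉ D → HasDerivAt Q (-B t) t)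
    (hB : ∃ M, ∀ t ∈ Icc a b, ∀ i j, |B t i j| ≤ M) :
    r a * (1 - (Q a - Q b) * r b) = r b := by
  obtain ⟨M, hM⟩ := exists_entry_bound_mul (exists_entry_bound_of_continuousOn hc) hB
  set E : ℝ → Matrix (Fin n) (Fin n) ℝ := fun t => r t * (1 - (Q t - Q b) * r b) - r b with hE_def
  have hE : ∀ t ∈ Ioo a b, t ∉ D → HasDerivAt E (-(r t * B t) * E t) t := by
    intro t ht htD
    have h := ((hr t ht htD).mul
      ((((hQ t ht htD).sub_const (Q b)).mul_const (r b)).const_sub 1)).sub_const (r b)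
    refine h.congr_deriv ?_
    simp only [hE_def]
    noncomm_ring
  have hEc : ContinuousOn E (Icc a b) := by fun_prop
  refine sub_eq_zero.1 (show E a = 0 from ?_)
  refine ext_iff_mulVec.2 fun v => ?_
  rw [zero_mulVec]
  refine (linear_ode_eq_zero_iff (y := fun s => E s *ᵥ v) (G := fun t => -(r t * B t)) (M := M)
    hD hab (by fun_prop) ?_ ?_).2 (by simp [hE_def])
  · intro t ht htD
    rw [mulVec_mulVec]
    exact HasDerivAt.matrix_mulVec_const (hE t ht htD) v
  · intro t ht i j
    rw [Matrix.neg_apply, abs_neg]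
    exact hM t (Ioo_subset_Icc_self ht) i j

/-- Conjugating the difference of two solutions of the Riccati equation with the fundamental
matrix `S` of `S' = -(A + Σ P)ᵀ S` reduces the Riccati equation to `r' = -r (Sᵀ Σ S) r`. -/
theorem hasDerivAt_reduced {n : ℕ} {A C Sig : Matrix (Fin n) (Fin n) ℝ}
    {P S p : ℝ → Matrix (Fin n) (Fin n) ℝ} {t : ℝ}
    (hSig : Sig.IsSymm) (hP' : (P t).IsSymm) (hu : IsUnit (S t).det)
    (hP : HasDerivAt P (-(Aᵀ * P t + P t * A + C + P t * Sig * P t)) t)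
    (hp : HasDerivAt p (-(Aᵀ * p t + p t * A + C + p t * Sig * p t)) t)
    (hS : HasDerivAt S (-((A + Sig * P t)ᵀ * S t)) t) :
    HasDerivAt (fun s => (S s)⁻¹ * (p s - P s) * ((S s)⁻¹)ᵀ)
      (-(((S t)⁻¹ * (p t - P t) * ((S t)⁻¹)ᵀ) * ((S t)ᵀ * Sig * S t) *
        ((S t)⁻¹ * (p t - P t) * ((S t)⁻¹)ᵀ))) t := by
  have hi := HasDerivAt.matrix_inv hS hu
  have h := (hi.mul (hp.sub hP)).mul (HasDerivAt.matrix_transpose hi)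
  refine h.congr_deriv ?_
  have e2 : S t * (S t)⁻¹ = 1 := mul_nonsing_inv _ hu
  have e4 : ((S t)⁻¹)ᵀ * (S t)ᵀ = 1 := by rw [← transpose_mul, e2, transpose_one]
  simp only [transpose_neg, transpose_mul, transpose_add, transpose_transpose, hSig.eq, hP'.eq,
    Pi.sub_apply, Pi.mul_apply]
  generalize ((S t)⁻¹)ᵀ = V at *
  generalize (S t)⁻¹ = U at *
  generalize (S t)ᵀ = R at *
  generalize S t = S at *
  have a2 : ∀ X, S * (U * X) = X := fun X => by rw [← mul_assoc, e2, one_mul]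
  have a4 : ∀ X, V * (R * X) = X := fun X => by rw [← mul_assoc, e4, one_mul]
  simp only [mul_assoc, a2, a4, e2, mul_add, add_mul, mul_sub, sub_mul, neg_mul, mul_neg, neg_neg,
    mul_one]
  noncomm_ring

end MatrixCalculus

/-! ### Quadratic functions and their semiconvex duals -/

theorem quad_convexOn {n : ℕ} {M : Matrix (Fin n) (Fin n) ℝ} (hM : M.PosSemidef) :
    ConvexOn ℝ univ (quad M) := by
  refine ⟨convex_univ, fun x _ y _ a b ha hb hab => ?_⟩
  have h := hM.dotProduct_mulVec_nonneg (x - y)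
  simp only [star_trivial, mulVec_sub, dotProduct_sub, sub_dotProduct] at h
  simp only [quad, mulVec_add, mulVec_smul, dotProduct_add, add_dotProduct, smul_dotProduct,
    dotProduct_smul, smul_eq_mul]
  obtain rfl : b = 1 - a := by linarith
  nlinarith [mul_nonneg (mul_nonneg ha hb) h]

theorem uniformlySemiconvex_quad {n : ℕ} {p P : Matrix (Fin n) (Fin n) ℝ}
    (h : (p - P).PosSemidef) : UniformlySemiconvex (-P) (quad p) := by
  unfold UniformlySemiconvex
  convert quad_convexOn h using 2 with x
  simp only [quad, neg_mulVec, sub_mulVec, dotProduct_neg, dotProduct_sub]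
  ring

theorem quad_sub_biquad {n : ℕ} (p P S Q : Matrix (Fin n) (Fin n) ℝ) (x z : Fin n → ℝ) :
    quad p x - biquad P S Q x z = quad (p - P) x - x ⬝ᵥ S *ᵥ z - quad Q z := by
  simp only [quad, biquad, sub_mulVec, dotProduct_sub]
  ring

/-- If the stationarity condition `(p - P) x = S z` has a solution, the dual is attained there. -/
theorem semiconvexDual_of_stationary {n : ℕ} {p P S Q : Matrix (Fin n) (Fin n) ℝ}
    (hd : (p - P).PosSemidef) {x z : Fin n → ℝ} (hx : (p - P) *ᵥ x = S *ᵥ z) :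
    semiconvexDual (biquad P S Q) (quad p) z =
      ((-(1 / 2 * (x ⬝ᵥ S *ᵥ z)) - quad Q z : ℝ) : EReal) := by
  unfold semiconvexDual
  simp only [quad_sub_biquad]
  have hT : (p - P)ᵀ = p - P := by simpa [IsHermitian] using! hd.isHermitian
  refine le_antisymm (iInf_le_of_le x ?_) (le_iInf fun y => ?_)
  · rw [EReal.coe_le_coe_iff, quad, hx]
    linarith
  · have h := hd.dotProduct_mulVec_nonneg (y - x)
    have h2 : x ⬝ᵥ (p - P) *ᵥ y = y ⬝ᵥ S *ᵥ z := by
      rw [dotProduct_mulVec, ← mulVec_transpose, hT, hx, dotProduct_comm]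
    rw [star_trivial, mulVec_sub, dotProduct_sub, sub_dotProduct, sub_dotProduct, h2, hx] at h
    rw [EReal.coe_le_coe_iff]
    simp only [quad] at h ⊢
    linarith

/-- Without a solution of the stationarity condition the objective is unbounded below along a
direction in the kernel of `p - P`. -/
theorem semiconvexDual_eq_bot {n : ℕ} {p P S Q : Matrix (Fin n) (Fin n) ℝ}
    (hd : (p - P).IsSymm) {z : Fin n → ℝ} (hz : ∀ x, (p - P) *ᵥ x ≠ S *ᵥ z) :
    semiconvexDual (biquad P S Q) (quad p) z = ⊥ := by
  have hmem : S *ᵥ z ∉ LinearMap.range (p - P).mulVecLin := by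
    rintro ⟨x, hx⟩
    exact hz x hx
  obtain ⟨f, hf, hker⟩ := Submodule.exists_le_ker_of_notMem hmem
  obtain ⟨k, hk⟩ : ∃ k : Fin n → ℝ, ∀ y, f y = k ⬝ᵥ y :=
    ⟨(dotProductEquiv ℝ (Fin n)).symm f, fun y => by
      conv_lhs => rw [← (dotProductEquiv ℝ (Fin n)).apply_symm_apply f]
      rfl⟩
  have hdk : (p - P) *ᵥ k = 0 := by
    refine dotProduct_eq _ _ fun y => ?_
    have := hker ⟨y, rfl⟩
    rw [LinearMap.mem_ker, hk] at this
    rw [zero_dotProduct, ← this, dotProduct_comm, mulVecLin_apply, dotProduct_mulVec,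
      ← mulVec_transpose, hd.eq, dotProduct_comm, dotProduct_comm]
  rw [hk] at hf
  refine EReal.eq_bot_iff_forall_lt _ |>.2 fun c => ?_
  refine (iInf_le _ (((-c - quad Q z + 1) / (k ⬝ᵥ S *ᵥ z)) • k)).trans_lt ?_
  rw [quad_sub_biquad, EReal.coe_lt_coe_iff, quad, mulVec_smul, hdk, smul_zero, dotProduct_zero,
    smul_dotProduct, smul_eq_mul, div_mul_cancel₀ _ hf]
  linarith

/-! ### The reduced solution `S⁻¹ (p - P) S⁻ᵀ` -/

/-- The solution `p` in the coordinates given by the kernel: `S⁻¹ (p - P) S⁻ᵀ`. When `p - P` is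
nonsingular its inverse is `Sᵀ (p - P)⁻¹ S`. -/
noncomputable def reduced {n : ℕ} (p P S : Matrix (Fin n) (Fin n) ℝ) : Matrix (Fin n) (Fin n) ℝ :=
  S⁻¹ * (p - P) * (S⁻¹)ᵀ

section Reduced

variable {n : ℕ} {p P S Q : Matrix (Fin n) (Fin n) ℝ}

theorem mul_reduced_mul (hS : IsUnit S.det) : S * reduced p P S * Sᵀ = p - P := by
  have h : (S⁻¹)ᵀ * Sᵀ = 1 := by rw [← transpose_mul, mul_nonsing_inv _ hS, transpose_one]
  rw [reduced, mul_assoc, mul_assoc, h, mul_one, ← mul_assoc, mul_nonsing_inv _ hS, one_mul]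

theorem reduced_isSymm (h : (p - P).IsSymm) : (reduced p P S).IsSymm := by
  rw [IsSymm, reduced, transpose_mul, transpose_mul, transpose_transpose, h.eq, mul_assoc]

theorem reduced_posSemidef (h : (p - P).PosSemidef) : (reduced p P S).PosSemidef := by
  simpa [reduced] using! h.mul_mul_conjTranspose_same S⁻¹

theorem posSemidef_of_reduced (hS : IsUnit S.det) (h : (reduced p P S).PosSemidef) :
    (p - P).PosSemidef := by
  rw [← mul_reduced_mul hS]
  simpa using! h.mul_mul_conjTranspose_same S

theorem isUnit_det_reduced_iff (hS : IsUnit S.det) :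
    IsUnit (reduced p P S).det ↔ IsUnit (p - P).det := by
  rw [← mul_reduced_mul (p := p) (P := P) hS, det_mul, det_mul, det_transpose]
  simp only [IsUnit.mul_iff, hS, true_and, and_true]

theorem transpose_mul_inv_mul (hS : IsUnit S.det) :
    Sᵀ * (p - P)⁻¹ * S = (reduced p P S)⁻¹ := by
  have hT : IsUnit Sᵀ.det := by rwa [det_transpose]
  rw [← mul_reduced_mul (p := p) (P := P) hS, Matrix.mul_inv_rev, Matrix.mul_inv_rev, ← mul_assoc,
    mul_nonsing_inv _ hT, one_mul, mul_assoc, nonsing_inv_mul _ hS, mul_one]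

/-- In the variable `w = Sᵀ x` the dual is `inf_w [½ wᵀ r w - wᵀ z] - ½ zᵀ Q z`, where `r` is the
reduced solution; its stationarity condition is `r w = z`. -/
theorem semiconvexDual_of_reduced (hS : IsUnit S.det) (hd : (p - P).PosSemidef)
    {w z : Fin n → ℝ} (hw : reduced p P S *ᵥ w = z) :
    semiconvexDual (biquad P S Q) (quad p) z = ((-(1 / 2 * (w ⬝ᵥ z)) - quad Q z : ℝ) : EReal) := by
  have hT : Sᵀ * (S⁻¹)ᵀ = 1 := by rw [← transpose_mul, nonsing_inv_mul _ hS, transpose_one]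
  rw [semiconvexDual_of_stationary hd (x := (S⁻¹)ᵀ *ᵥ w)]
  · rw [mulVec_transpose, dotProduct_mulVec, vecMul_vecMul, nonsing_inv_mul _ hS, vecMul_one]
  · rw [← mul_reduced_mul (p := p) (P := P) hS, mulVec_mulVec, mul_assoc, hT, mul_one,
      ← mulVec_mulVec, hw]

theorem semiconvexDual_eq_bot_of_reduced (hS : IsUnit S.det) (hd : (p - P).IsSymm)
    {z : Fin n → ℝ} (hz : ∀ w, reduced p P S *ᵥ w ≠ z) :
    semiconvexDual (biquad P S Q) (quad p) z = ⊥ := by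
  refine semiconvexDual_eq_bot hd fun x hx => hz (Sᵀ *ᵥ x) ?_
  rw [← mul_reduced_mul (p := p) (P := P) hS, ← mulVec_mulVec, ← mulVec_mulVec] at hx
  exact mulVec_injective_of_isUnit ((isUnit_iff_isUnit_det _).2 hS) hx

end Reduced

/-! ### Propagation of the reduced solution -/

theorem Icc_subset_horizon {Tbar : EReal} {T t₁ t₂ : ℝ} (h₁ : t₁ ∈ horizon Tbar T)
    (h₂ : t₂ ∈ horizon Tbar T) : Icc t₁ t₂ ⊆ horizon Tbar T :=
  fun _ ht => ⟨h₁.1.trans_le (EReal.coe_le_coe_iff.2 ht.1), ht.2.trans h₂.2⟩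

theorem diffusion_isSymm {n m : ℕ} (σ : ℝ → Matrix (Fin n) (Fin m) ℝ) (t : ℝ) :
    (diffusion σ t).IsSymm := by
  rw [IsSymm, diffusion, transpose_mul, transpose_transpose]

theorem diffusion_posSemidef {n m : ℕ} (σ : ℝ → Matrix (Fin n) (Fin m) ℝ) (t : ℝ) :
    (diffusion σ t).PosSemidef := by
  simpa [diffusion] using! posSemidef_self_mul_conjTranspose (σ t)

section MatrixCalculus

attribute [local instance] Matrix.linftyOpNormedAddCommGroup Matrix.linftyOpNormedSpace
  Matrix.linftyOpNormedRing Matrix.linftyOpNormedAlgebra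

/-- The reduced solution `r` decreases in time, and `r(t₁)⁻¹ = r(t₂)⁻¹ - (Q(t₁) - Q(t₂))` in a
form that does not need the inverses. -/
theorem reduced_propagation {n m : ℕ} {Tbar : EReal} {T : ℝ}
    {A C : ℝ → Matrix (Fin n) (Fin n) ℝ} {σ : ℝ → Matrix (Fin n) (Fin m) ℝ}
    {P S Q p : ℝ → Matrix (Fin n) (Fin n) ℝ} {t₁ t₂ : ℝ}
    (ht₁ : t₁ ∈ horizon Tbar T) (ht₂ : t₂ ∈ horizon Tbar T)
    (hA1 : StandingAssumptions Tbar T A C σ P S Q) (hlt : t₁ < t₂)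
    (hp : IsRiccatiSolution A C (diffusion σ) (Icc t₁ t₂) p) (hS₂ : IsUnit (S t₂).det) :
    IsUnit (S t₁).det ∧
      (reduced (p t₁) (P t₁) (S t₁) - reduced (p t₂) (P t₂) (S t₂)).PosSemidef ∧
      reduced (p t₁) (P t₁) (S t₁) * (1 - (Q t₁ - Q t₂) * reduced (p t₂) (P t₂) (S t₂)) =
        reduced (p t₂) (P t₂) (S t₂) := by
  have hJ := Icc_subset_horizon ht₁ ht₂
  obtain ⟨DA, hDA, hA⟩ := hA1.pc_A
  obtain ⟨DC, hDC, hC⟩ := hA1.pc_C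
  obtain ⟨DG, hDG, hG⟩ := hA1.pc_Sig
  have hD : ((DA ∪ DC ∪ DG) ∩ Icc t₁ t₂).Finite := by
    rw [union_inter_distrib_right, union_inter_distrib_right]
    exact ((hDA _ ht₁ _ ht₂).union (hDC _ ht₁ _ ht₂)).union (hDG _ ht₁ _ ht₂)
  set D := (DA ∪ DC ∪ DG) ∩ Icc t₁ t₂ with hD_def
  have hnhds : ∀ t ∈ Ioo t₁ t₂, horizon Tbar T ∈ nhds t := fun t ht =>
    Filter.mem_of_superset (Icc_mem_nhds ht.1 ht.2) hJ
  have hcont : ∀ t ∈ Ioo t₁ t₂, t ∉ D → ContinuousWithinAt A (horizon Tbar T) t ∧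
      ContinuousWithinAt C (horizon Tbar T) t ∧
      ContinuousWithinAt (diffusion σ) (horizon Tbar T) t := by
    intro t ht htD
    have hI := Ioo_subset_Icc_self ht
    have h3 : t ∉ DA ∧ t ∉ DC ∧ t ∉ DG :=
      ⟨fun h => htD ⟨.inl (.inl h), hI⟩, fun h => htD ⟨.inl (.inr h), hI⟩, fun h => htD ⟨.inr h, hI⟩⟩
    exact ⟨hA t (hJ hI) h3.1, hC t (hJ hI) h3.2.1, hG t (hJ hI) h3.2.2⟩
  have hk := hA1.kernel
  have hP' : ∀ t ∈ Ioo t₁ t₂, t ∉ D → HasDerivAt P (-((A t)ᵀ * P t + P t * A t + C t +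
      P t * diffusion σ t * P t)) t := fun t ht htD => by
    obtain ⟨h1, h2, h3⟩ := hcont t ht htD
    exact hasDerivAt_matrix fun i j => (hk.riccati.deriv t (hJ (Ioo_subset_Icc_self ht)) h1 h2 h3
      i j).hasDerivAt (hnhds t ht)
  have hp' : ∀ t ∈ Ioo t₁ t₂, t ∉ D → HasDerivAt p (-((A t)ᵀ * p t + p t * A t + C t +
      p t * diffusion σ t * p t)) t := fun t ht htD => by
    obtain ⟨h1, h2, h3⟩ := hcont t ht htD
    exact hasDerivAt_matrix fun i j => (hp.deriv t (Ioo_subset_Icc_self ht) (h1.mono hJ)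
      (h2.mono hJ) (h3.mono hJ) i j).hasDerivAt (Icc_mem_nhds ht.1 ht.2)
  have hS' : ∀ t ∈ Ioo t₁ t₂, t ∉ D → HasDerivAt S (-((A t + diffusion σ t * P t)ᵀ * S t)) t :=
    fun t ht htD => by
    obtain ⟨h1, h2, h3⟩ := hcont t ht htD
    exact hasDerivAt_matrix fun i j => (hk.deriv_S t (hJ (Ioo_subset_Icc_self ht)) h1 h2 h3
      i j).hasDerivAt (hnhds t ht)
  have hQ' : ∀ t ∈ Ioo t₁ t₂, t ∉ D → HasDerivAt Q (-((S t)ᵀ * diffusion σ t * S t)) t :=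
    fun t ht htD => by
    obtain ⟨h1, h2, h3⟩ := hcont t ht htD
    exact hasDerivAt_matrix fun i j => (hk.deriv_Q t (hJ (Ioo_subset_Icc_self ht)) h1 h2 h3
      i j).hasDerivAt (hnhds t ht)
  have hPc := hk.riccati.continuousOn.mono hJ
  have hSc := hk.continuousOn_S.mono hJ
  have hQc := hk.continuousOn_Q.mono hJ
  have hpc := hp.continuousOn
  have hSig := hA1.bdd_Sig t₁ ht₁ t₂ ht₂
  have hunit : ∀ t ∈ Icc t₁ t₂, IsUnit (S t).det := by
    refine isUnit_det_of_linear_ode (G := fun t => -(A t + diffusion σ t * P t)ᵀ) hD hSc ?_ ?_ hS₂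
    · exact fun t ht htD => (hS' t ht htD).congr_deriv (neg_mul _ _).symm
    · obtain ⟨M, hM⟩ := hA1.bdd_A t₁ ht₁ t₂ ht₂
      obtain ⟨N, hN⟩ := exists_entry_bound_mul hSig (exists_entry_bound_of_continuousOn hPc)
      refine ⟨M + N, fun t ht i j => ?_⟩
      rw [Matrix.neg_apply, abs_neg, transpose_apply, Matrix.add_apply]
      exact (abs_add_le _ _).trans (add_le_add (hM t ht j i) (hN t ht j i))
  have hinvc : ContinuousOn (fun t => (S t)⁻¹) (Icc t₁ t₂) := by
    intro t ht
    have h1 : ContinuousAt Ring.inverse (S t) := by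
      obtain ⟨u, hu⟩ := (isUnit_iff_isUnit_det _).2 (hunit t ht)
      rw [← hu]
      exact NormedRing.inverse_continuousAt u
    simp only [nonsing_inv_eq_ringInverse]
    exact h1.comp_continuousWithinAt (hSc t ht)
  have hrc : ContinuousOn (fun t => reduced (p t) (P t) (S t)) (Icc t₁ t₂) := by
    unfold reduced
    fun_prop
  have hr' : ∀ t ∈ Ioo t₁ t₂, t ∉ D → HasDerivAt (fun t => reduced (p t) (P t) (S t))
      (-(reduced (p t) (P t) (S t) * ((S t)ᵀ * diffusion σ t * S t) *
        reduced (p t) (P t) (S t))) t := fun t ht htD =>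
    hasDerivAt_reduced (diffusion_isSymm σ t)
      (hk.riccati.symm t (hJ (Ioo_subset_Icc_self ht))) (hunit t (Ioo_subset_Icc_self ht))
      (hP' t ht htD) (hp' t ht htD) (hS' t ht htD)
  -- with `B = Sᵀ Σ S ⪰ 0` the reduced solution satisfies `r' = -r B r`, and `Q' = -B`
  refine ⟨hunit t₁ (left_mem_Icc.2 hlt.le), ?_, ?_⟩
  · exact posSemidef_sub_of_reduced_riccati hD hlt.le hrc hr'
      (fun t ht => reduced_isSymm ((hp.symm t ht).sub (hk.riccati.symm t (hJ ht))))
      fun t => by simpa using! (diffusion_posSemidef σ t).conjTranspose_mul_mul_same (S t)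
  · refine reduced_riccati_formula hD hlt.le hrc hQc hr' hQ' (exists_entry_bound_mul
      (exists_entry_bound_mul (exists_entry_bound_of_continuousOn ?_) hSig)
      (exists_entry_bound_of_continuousOn hSc))
    fun_prop

end MatrixCalculus

end DRE

theorem mainTheorem4 {n m : ℕ} (Tbar : EReal) (T : ℝ)
    (A C : ℝ → Matrix (Fin n) (Fin n) ℝ) (σ : ℝ → Matrix (Fin n) (Fin m) ℝ)
    (P S Q p : ℝ → Matrix (Fin n) (Fin n) ℝ) (t₁ t₂ : ℝ)
    (ht₁ : t₁ ∈ DRE.horizon Tbar T) (ht₂ : t₂ ∈ DRE.horizon Tbar T)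
    (hA1 : DRE.StandingAssumptions Tbar T A C σ P S Q)
    (hA2 : DRE.DualityAssumptions A C σ P S Q p t₁ t₂) :
    -- the dual of `½ x' p(t₁) x` under the kernel at time `t₁` exists
    (DRE.UniformlySemiconvex (-(P t₁)) (DRE.quad (p t₁)) ∧ IsUnit (S t₁).det) ∧
    -- the two duals coincide
    (∀ z : Fin n → ℝ,
      DRE.semiconvexDual (DRE.biquad (P t₂) (S t₂) (Q t₂)) (DRE.quad (p t₂)) z =
        DRE.semiconvexDual (DRE.biquad (P t₁) (S t₁) (Q t₁)) (DRE.quad (p t₁)) z) ∧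
    -- they are finite exactly when `p(t₂) - P(t₂)` is invertible
    ((∀ z : Fin n → ℝ,
      DRE.semiconvexDual (DRE.biquad (P t₂) (S t₂) (Q t₂)) (DRE.quad (p t₂)) z ≠ ⊥) ↔
        IsUnit (p t₂ - P t₂).det) ∧
    -- in that case: the matrix form and the propagation formula
    (IsUnit (p t₂ - P t₂).det →
      (p t₁ - P t₁).PosDef ∧
      (∀ z : Fin n → ℝ,
        DRE.semiconvexDual (DRE.biquad (P t₂) (S t₂) (Q t₂)) (DRE.quad (p t₂)) z =
          (DRE.quad (-((S t₂)ᵀ * (p t₂ - P t₂)⁻¹ * S t₂) - Q t₂) z : EReal)) ∧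
      -((S t₂)ᵀ * (p t₂ - P t₂)⁻¹ * S t₂) - Q t₂ =
        -((S t₁)ᵀ * (p t₁ - P t₁)⁻¹ * S t₁) - Q t₁ ∧
      IsUnit (Q t₁ - Q t₂ - (S t₂)ᵀ * (p t₂ - P t₂)⁻¹ * S t₂).det ∧
      p t₁ = P t₁ -
        S t₁ * (Q t₁ - Q t₂ - (S t₂)ᵀ * (p t₂ - P t₂)⁻¹ * S t₂)⁻¹ * (S t₁)ᵀ) := by
  have hle := hA2.le
  have hS₂ := hA2.nonsingular
  obtain ⟨hS₁, hmono, hform⟩ :=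
    DRE.reduced_propagation ht₁ ht₂ hA1 hA2.lt hA2.riccati hS₂
  have hunit₂ := DRE.isUnit_det_reduced_iff (p := p t₂) (P := P t₂) hS₂
  have hunit₁ := DRE.isUnit_det_reduced_iff (p := p t₁) (P := P t₁) hS₁
  have hr₂ := DRE.reduced_posSemidef (S := S t₂) hle
  have hr₁ : (DRE.reduced (p t₁) (P t₁) (S t₁)).PosSemidef := by simpa using hmono.add hr₂
  have hle₁ := DRE.posSemidef_of_reduced hS₁ hr₁
  have hsymm : ∀ {M : Matrix (Fin n) (Fin n) ℝ}, M.PosSemidef → M.IsSymm := fun hM => by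
    simpa [IsHermitian] using! hM.isHermitian
  -- the transpose of `hform`
  have hform' : DRE.reduced (p t₂) (P t₂) (S t₂) * (1 + (Q t₁ - Q t₂) *
      DRE.reduced (p t₁) (P t₁) (S t₁)) = DRE.reduced (p t₁) (P t₁) (S t₁) := by
    have hW : (Q t₁ - Q t₂)ᵀ = Q t₁ - Q t₂ :=
      ((hA1.kernel.symm t₁ ht₁).sub (hA1.kernel.symm t₂ ht₂)).eq
    have h := congrArg transpose hform
    rw [transpose_mul, transpose_sub, transpose_mul, transpose_one, (hsymm hr₁).eq,
      (hsymm hr₂).eq, hW, sub_mul, one_mul, sub_eq_iff_eq_add] at h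
    rw [mul_add, mul_one, ← mul_assoc]
    exact h.symm
  have hdual₂ := fun z w => DRE.semiconvexDual_of_reduced (Q := Q t₂) (w := w) (z := z) hS₂ hle
  have hdual₁ := fun z w => DRE.semiconvexDual_of_reduced (Q := Q t₁) (w := w) (z := z) hS₁ hle₁
  have hbot₂ := fun z => DRE.semiconvexDual_eq_bot_of_reduced (Q := Q t₂) (z := z) hS₂ (hsymm hle)
  have hbot₁ := fun z => DRE.semiconvexDual_eq_bot_of_reduced (Q := Q t₁) (z := z) hS₁ (hsymm hle₁)
  have hinv₂ := DRE.transpose_mul_inv_mul (p := p t₂) (P := P t₂) hS₂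
  have hinv₁ := DRE.transpose_mul_inv_mul (p := p t₁) (P := P t₁) hS₁
  have hrec₁ := DRE.mul_reduced_mul (p := p t₁) (P := P t₁) hS₁
  rw [hinv₂, hinv₁]
  generalize DRE.reduced (p t₁) (P t₁) (S t₁) = r₁ at *
  generalize DRE.reduced (p t₂) (P t₂) (S t₂) = r₂ at *
  refine ⟨⟨DRE.uniformlySemiconvex_quad hle₁, hS₁⟩, fun z => ?_, ⟨fun h => ?_, fun h z => ?_⟩,
    fun h => ?_⟩
  · by_cases hz : ∃ w, r₂ *ᵥ w = z
    · obtain ⟨w, hw⟩ := hz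
      -- if `z = r₂ w` then `z = r₁ (w - (Q t₁ - Q t₂) z)`
      have hw₁ : r₁ *ᵥ (w - (Q t₁ - Q t₂) *ᵥ z) = z := by
        have h : w - (Q t₁ - Q t₂) *ᵥ r₂ *ᵥ w = (1 - (Q t₁ - Q t₂) * r₂) *ᵥ w := by
          rw [sub_mulVec 1, one_mulVec, ← mulVec_mulVec]
        rw [← hw, h, mulVec_mulVec, hform]
      rw [hdual₂ z w hw, hdual₁ z _ hw₁, EReal.coe_eq_coe_iff]
      simp only [DRE.quad, sub_mulVec, sub_dotProduct]
      rw [dotProduct_comm (Q t₁ *ᵥ z), dotProduct_comm (Q t₂ *ᵥ z)]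
      ring
    · -- conversely `z = r₁ w` gives `z = r₂ (w + (Q t₁ - Q t₂) z)`, so both duals are `⊥`
      push Not at hz
      rw [hbot₂ z hz, hbot₁ z]
      intro w hw
      refine hz ((1 + (Q t₁ - Q t₂) * r₁) *ᵥ w) ?_
      rw [mulVec_mulVec, hform', hw]
  · rw [← hunit₂, ← isUnit_iff_isUnit_det, ← mulVec_surjective_iff_isUnit]
    intro z
    by_contra hz
    exact h z (hbot₂ z fun w hw => hz ⟨w, hw⟩)
  · rw [← hunit₂, ← isUnit_iff_isUnit_det, ← mulVec_surjective_iff_isUnit] at h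
    obtain ⟨w, hw⟩ := h z
    rw [hdual₂ z w hw]
    exact EReal.coe_ne_bot _
  · rw [← hunit₂] at h
    have hu₁ : r₁ * ((1 - (Q t₁ - Q t₂) * r₂) * r₂⁻¹) = 1 := by
      rw [← mul_assoc, hform, mul_nonsing_inv _ h]
    have hi₁ : r₁⁻¹ = r₂⁻¹ - (Q t₁ - Q t₂) := by
      rw [inv_eq_right_inv hu₁, sub_mul, one_mul, mul_assoc, mul_nonsing_inv _ h, mul_one]
    have hdet₁ : IsUnit r₁.det := (isUnit_iff_isUnit_det _).1 (IsUnit.of_mul_eq_one _ hu₁)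
    have hneg : Q t₁ - Q t₂ - r₂⁻¹ = -r₁⁻¹ := by rw [hi₁, neg_sub]
    have hneg' : (-r₁⁻¹)⁻¹ = -r₁ :=
      inv_eq_right_inv (by rw [neg_mul_neg, nonsing_inv_mul _ hdet₁])
    refine ⟨hle₁.posDef_iff_isUnit.2 ((isUnit_iff_isUnit_det _).2 (hunit₁.1 hdet₁)),
      fun z => ?_, ?_, ?_, ?_⟩
    · rw [hdual₂ z (r₂⁻¹ *ᵥ z) (by rw [mulVec_mulVec, mul_nonsing_inv _ h, one_mulVec]),
        dotProduct_comm, EReal.coe_eq_coe_iff]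
      simp only [DRE.quad, sub_mulVec, neg_mulVec, dotProduct_sub, dotProduct_neg]
      ring
    · rw [hi₁]
      abel
    · rw [hneg, ← isUnit_iff_isUnit_det]
      exact ((isUnit_iff_isUnit_det _).2 (isUnit_nonsing_inv_det _ hdet₁)).neg
    · rw [hneg, hneg', mul_neg, neg_mul, sub_neg_eq_add, hrec₁, add_sub_cancel]
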